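/- Let $K$ be a field, let $R=K[x,y,z]$ be the polynomial ring in three variables over $K$, let $c$ be a positive integer, and let $I=(x^{2c+2},\,xy^{2c}z,\,y^{2c+2}z)\subset R$. For an ideal $J\subset R$ write $\operatorname{Ass}(J)$ for the set of associated prime ideals of the $R$-module $R/J$, and $\overline{J}$ for the integral closure of $J$, i.e. the ideal of all $r\in R$ satisfying an equation $r^n+a_1r^{n-1}+\cdots+a_n=0$ with $n\ge 1$ and $a_j\in J^j$ for $j=1,\dots,n$. Let $\operatorname{astab}(I)$ be the smallest integer $k_0\ge 1$ such that $\operatorname{Ass}(I^k)=\operatorname{Ass}(I^{k_0})$ for all $k\ge k_0$, and let $\overline{\operatorname{astab}}(I)$ be the smallest integer $k_0\ge 1$ such that $\operatorname{Ass}(\overline{I^k})=\operatorname{Ass}(\overline{I^{k_0}})$ for all $k\ge k_0$. Then $$\operatorname{astab}(I)=c+2\quad\text{and}\quad \overline{\operatorname{astab}}(I)=2 .$$ In particular $\operatorname{astab}(I)-\overline{\operatorname{astab}}(I)=c$, so for every positive integer $c$ there is a monomial ideal in $K[x,y,z]$ for which the two indices differ by exactly $c$. -/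

import Mathlib

namespace AssStability

open Polynomial

/-- `r` is integral over the ideal `I`: it satisfies an equation
`r ^ n + a₁ r ^ (n - 1) + ⋯ + aₙ = 0` with `aⱼ ∈ I ^ j` for `j = 1, …, n`
(here `aⱼ` is the coefficient of index `n - j` of a monic polynomial `p` of degree `n`). -/
def IsIntegralOverIdeal {R : Type*} [CommRing R] (I : Ideal R) (r : R) : Prop :=
  ∃ p : R[X], p.Monic ∧ p.eval r = 0 ∧ ∀ i, p.coeff i ∈ I ^ (p.natDegree - i)

theorem isIntegralOverIdeal_iff {R : Type*} [CommRing R] (I : Ideal R) (r : R) :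
    IsIntegralOverIdeal I r ↔ IsIntegral (reesAlgebra I) (monomial 1 r : R[X]) := by
  constructor
  · rintro ⟨p, hp, h0, hc⟩
    let f : ℕ → reesAlgebra I := fun i =>
      ⟨monomial (p.natDegree - i) (p.coeff i), reesAlgebra.monomial_mem.mpr (hc i)⟩
    refine ⟨X ^ p.natDegree + ∑ i ∈ Finset.range p.natDegree, C (f i) * X ^ i, ?_, ?_⟩
    · refine monic_X_pow_add ((degree_sum_le _ _).trans_lt ?_)
      refine (Finset.sup_lt_iff (WithBot.bot_lt_coe _)).mpr fun i hi => ?_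
      exact (degree_C_mul_X_pow_le _ _).trans_lt
        (WithBot.coe_lt_coe.mpr (Finset.mem_range.mp hi))
    · have key : ∀ i ∈ Finset.range p.natDegree,
          algebraMap (reesAlgebra I) R[X] (f i) * (monomial 1 r : R[X]) ^ i =
            monomial p.natDegree (p.coeff i * r ^ i) := by
        intro i hi
        have hi' := Finset.mem_range.mp hi
        change monomial (p.natDegree - i) (p.coeff i) * (monomial 1 r : R[X]) ^ i = _
        rw [monomial_pow, monomial_mul_monomial]
        congr 2
        omega
      simp only [eval₂_add, eval₂_finsetSum, eval₂_mul, eval₂_C, eval₂_X_pow]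
      rw [Finset.sum_congr rfl key, monomial_pow, one_mul, ← map_sum, ← map_add]
      rw [eval_eq_sum_range, Finset.sum_range_succ, hp.coeff_natDegree, one_mul, add_comm] at h0
      rw [h0, map_zero]
  · rintro ⟨q, hq, h0⟩
    rcases subsingleton_or_nontrivial R with hR | hR
    · refine ⟨1, monic_one, Subsingleton.elim _ _, fun i => ?_⟩
      rw [Subsingleton.elim ((1 : R[X]).coeff i) 0]
      exact zero_mem _
    set n := q.natDegree with hn
    let p : R[X] := X ^ n + ∑ i ∈ Finset.range n, C ((q.coeff i : R[X]).coeff (n - i)) * X ^ i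
    have hdeg : (∑ i ∈ Finset.range n,
        C ((q.coeff i : R[X]).coeff (n - i)) * X ^ i : R[X]).degree < n := by
      refine (degree_sum_le _ _).trans_lt ?_
      refine (Finset.sup_lt_iff (WithBot.bot_lt_coe _)).mpr fun i hi => ?_
      exact (degree_C_mul_X_pow_le _ _).trans_lt
        (WithBot.coe_lt_coe.mpr (Finset.mem_range.mp hi))
    have hpn : p.natDegree = n := by
      refine natDegree_eq_of_degree_eq_some ?_
      rw [degree_add_eq_left_of_degree_lt] <;> rw [degree_X_pow]
      exact hdeg
    refine ⟨p, monic_X_pow_add hdeg, ?_, ?_⟩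
    · have h1 := congrArg (fun g : R[X] => g.coeff n) h0
      rw [eval₂_eq_sum_range] at h1
      simp only [finsetSum_coeff, coeff_zero] at h1
      rw [← hn, Finset.sum_range_succ, hn, hq.coeff_natDegree, ← hn, map_one, one_mul,
        monomial_pow, one_mul, coeff_monomial_same, add_comm] at h1
      rw [← h1]
      simp only [p, eval_add, eval_finsetSum, eval_mul, eval_C, eval_pow, eval_X]
      congr 1
      refine Finset.sum_congr rfl fun i hi => ?_
      have hi' := Finset.mem_range.mp hi
      rw [monomial_pow, one_mul]
      conv_rhs => rw [show n = (n - i) + i by omega]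
      rw [coeff_mul_monomial]
      rfl
    · intro i
      rw [hpn]
      rcases lt_or_ge i n with hi | hi
      · have : p.coeff i = (q.coeff i : R[X]).coeff (n - i) := by
          simp only [p, coeff_add, coeff_X_pow, finsetSum_coeff, coeff_C_mul]
          rw [if_neg hi.ne, zero_add, Finset.sum_eq_single i]
          · simp
          · intro j _ hj
            rw [if_neg hj.symm, mul_zero]
          · intro h
            exact absurd (Finset.mem_range.mpr hi) h
        rw [this]
        exact (q.coeff i).2 (n - i)
      · rw [Nat.sub_eq_zero_of_le hi, pow_zero, Ideal.one_eq_top]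
        trivial

/-- The integral closure of an ideal `I`: the ideal of all elements integral over `I`. -/
def idealIntegralClosure {R : Type*} [CommRing R] (I : Ideal R) : Ideal R where
  carrier := {r | IsIntegralOverIdeal I r}
  add_mem' {a b} ha hb := by
    rw [Set.mem_ofPred_eq, isIntegralOverIdeal_iff] at *
    rw [map_add]
    exact ha.add hb
  zero_mem' := by
    rw [Set.mem_ofPred_eq, isIntegralOverIdeal_iff, map_zero]
    exact isIntegral_zero
  smul_mem' a r hr := by
    rw [Set.mem_ofPred_eq, isIntegralOverIdeal_iff] at *
    have h := (isIntegral_algebraMap (R := reesAlgebra I) (A := R[X])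
      (x := algebraMap R (reesAlgebra I) a)).mul hr
    have e : algebraMap (reesAlgebra I) R[X] (algebraMap R (reesAlgebra I) a) *
        (monomial 1 r : R[X]) = monomial 1 (a • r) := by
      change C a * monomial 1 r = _
      rw [C_mul_monomial, smul_eq_mul]
    rwa [e] at h

/-- `Ass(I)`, the set of associated primes of the `R`-module `R / I`. -/
def Ass {R : Type*} [CommRing R] (I : Ideal R) : Set (Ideal R) :=
  associatedPrimes R (R ⧸ I)

/-- The smallest integer `k₀ ≥ 1` with `Ass(I ^ k) = Ass(I ^ k₀)` for all `k ≥ k₀`.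
(If there were no such integer the value would be `0`, so a positive value of `astab I` is the
least element of the set.) -/
noncomputable def astab {R : Type*} [CommRing R] (I : Ideal R) : ℕ :=
  sInf {k₀ | 1 ≤ k₀ ∧ ∀ k, k₀ ≤ k → Ass (I ^ k) = Ass (I ^ k₀)}

/-- The smallest integer `k₀ ≥ 1` such that, for all `k ≥ k₀`, the integral closures of `I ^ k` and
of `I ^ k₀` have the same associated primes (with the same remark about the value `0`). -/
noncomputable def astabBar {R : Type*} [CommRing R] (I : Ideal R) : ℕ :=
  sInf {k₀ | 1 ≤ k₀ ∧ ∀ k, k₀ ≤ k →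
    Ass (idealIntegralClosure (I ^ k)) = Ass (idealIntegralClosure (I ^ k₀))}

/-- The ideal `(x ^ (2c+2), x y ^ (2c) z, y ^ (2c+2) z)` of `K[x, y, z]`. -/
noncomputable def exampleIdeal (K : Type*) [Field K] (c : ℕ) : Ideal (MvPolynomial (Fin 3) K) :=
  let x : MvPolynomial (Fin 3) K := MvPolynomial.X 0
  let y : MvPolynomial (Fin 3) K := MvPolynomial.X 1
  let z : MvPolynomial (Fin 3) K := MvPolynomial.X 2
  Ideal.span {x ^ (2 * c + 2), x * y ^ (2 * c) * z, y ^ (2 * c + 2) * z}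

end AssStability

/-!
A prime associated to a monomial ideal is generated by a set of variables, and which sets occur can
be read off from the exponents of the monomials in the ideal. Both `I ^ k` and its integral closure
are monomial ideals, the latter containing the monomials with exponents in `k` times the Newton
polyhedron of `I`: the facet inequalities persist under integral closure because they bound
monomial valuations, and conversely some power of each such monomial lies in the corresponding power
of `I ^ k`. For every `k ≥ 1` the associated primes other than `(x, y, z)` of any monomial ideal
between the two are exactly `(x, y)` and `(x, z)`, so the indices are decided by `(x, y, z)`. It is
associated if and only if the quotient has a monomial in its socle, which happens for `I ^ k` from
`k = c + 2` on and for the integral closure from `k = 2` on.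
-/

namespace AssStability

open MvPolynomial

section IntegralClosure

variable {R : Type*} [CommRing R] {I : Ideal R} {r : R}

theorem isIntegralOverIdeal_of_pow_mem {n : ℕ} (hn : n ≠ 0) (h : r ^ n ∈ I ^ n) :
    IsIntegralOverIdeal I r := by
  rw [isIntegralOverIdeal_iff]
  refine IsIntegral.of_pow (Nat.pos_of_ne_zero hn) ?_
  rw [Polynomial.monomial_pow, one_mul]
  exact isIntegral_algebraMap (R := reesAlgebra I)
    (x := ⟨Polynomial.monomial n (r ^ n), reesAlgebra.monomial_mem.mpr h⟩)

theorem natCast_mul_le_addValuation_of_mem_pow {v : AddValuation R ℕ∞} {h : ℕ∞}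
    (hI : ∀ a ∈ I, h ≤ v a) (n : ℕ) : ∀ a ∈ I ^ n, n * h ≤ v a := by
  induction n with
  | zero => simp
  | succ n ih =>
    intro a ha
    rw [pow_succ] at ha
    induction ha using Submodule.mul_induction_on' with
    | mem_mul_mem b hb d hd =>
      rw [Nat.cast_succ, add_one_mul, v.map_mul]
      exact add_le_add (ih b hb) (hI d hd)
    | add b _ d _ hb hd => exact (le_min hb hd).trans (v.map_add b d)

theorem IsIntegralOverIdeal.le_addValuation {v : AddValuation R ℕ∞} {h : ℕ∞}
    (hI : ∀ a ∈ I, h ≤ v a) (hr : IsIntegralOverIdeal I r) : h ≤ v r := by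
  obtain ⟨p, hp, h0, hcoeff⟩ := hr
  by_contra! hlt
  have hne_top (n : ℕ) : n * v r ≠ ⊤ := WithTop.mul_ne_top (ENat.natCast_ne_top n) hlt.ne_top
  have hpow : r ^ p.natDegree = -∑ i ∈ Finset.range p.natDegree, p.coeff i * r ^ i := by
    rw [Polynomial.eval_eq_sum_range, Finset.sum_range_succ, hp.coeff_natDegree, one_mul] at h0
    exact eq_neg_of_add_eq_zero_right h0
  have hterm : ∀ i ∈ Finset.range p.natDegree, p.natDegree * v r < v (p.coeff i * r ^ i) := by
    intro i hi
    obtain ⟨j, hj⟩ := Nat.exists_eq_add_of_lt (Finset.mem_range.mp hi)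
    have hcoe := natCast_mul_le_addValuation_of_mem_pow hI (j + 1) (p.coeff i)
      (by simpa [hj, add_assoc] using hcoeff i)
    calc p.natDegree * v r = (j + 1 : ℕ) * v r + i * v r := by
          rw [← add_mul, hj]
          push_cast
          ring
      _ < v (p.coeff i) + i * v r :=
          (ENat.add_lt_add_iff_right (hne_top i)).mpr <| lt_of_lt_of_le
            (ENat.mul_right_strictMono (by simp) (ENat.natCast_ne_top _) hlt) hcoe
      _ = v (p.coeff i * r ^ i) := by rw [v.map_mul, v.map_pow, nsmul_eq_mul]
  have hsum := v.map_lt_sum (hne_top _) hterm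
  rw [← v.map_neg (∑ i ∈ _, _), ← hpow, v.map_pow, nsmul_eq_mul] at hsum
  exact hsum.false

end IntegralClosure

section WeightValuation

variable {σ D : Type*} [CommRing D] [IsDomain D]

/-- The monomial valuation of `D[X]` with weights `w`: the least `w`-weight of a monomial occurring
in a polynomial, and `⊤` at `0`. -/
noncomputable def weightValuation (D : Type*) [CommRing D] [IsDomain D] (w : σ → ℕ) :
    AddValuation (MvPolynomial σ D) ℕ∞ :=
  (AddValuation.of (MvPowerSeries.weightedOrder w) (MvPowerSeries.weightedOrder_zero w)
    (MvPowerSeries.weightedOrder_one w) (fun _ _ => MvPowerSeries.min_weightedOrder_le_add w)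
    (MvPowerSeries.weightedOrder_mul w)).comap coeToMvPowerSeries.ringHom

theorem le_weightValuation_iff {w : σ → ℕ} {h : ℕ} {f : MvPolynomial σ D} :
    (h : ℕ∞) ≤ weightValuation D w f ↔ ∀ m ∈ f.support, h ≤ Finsupp.weight w m := by
  change (h : ℕ∞) ≤ MvPowerSeries.weightedOrder w (f : MvPowerSeries σ D) ↔ _
  refine ⟨fun hf m hm => ?_, fun hf => MvPowerSeries.nat_le_weightedOrder w fun m hm => ?_⟩
  · rw [mem_support_iff, ← coeff_coe] at hm
    exact_mod_cast hf.trans (MvPowerSeries.weightedOrder_le w hm)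
  · rw [coeff_coe, ← notMem_support_iff]
    exact fun hms => hm.not_ge (hf m hms)

end WeightValuation

section MonomialIdeals

variable {σ D : Type*} [CommRing D] {E F : Set (σ →₀ ℕ)}

theorem mem_restrictSupportIdeal {hE : IsUpperSet E} {f : MvPolynomial σ D} :
    f ∈ restrictSupportIdeal D E hE ↔ ∀ m ∈ f.support, m ∈ E :=
  Iff.rfl

theorem restrictSupportIdeal_le_iff {hE : IsUpperSet E} {J : Ideal (MvPolynomial σ D)} :
    restrictSupportIdeal D E hE ≤ J ↔ ∀ m ∈ E, monomial m 1 ∈ J := by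
  refine ⟨fun h m hm => h fun n hn => ?_, fun h f hf => ?_⟩
  · rwa [Finset.mem_singleton.mp (support_monomial_subset hn)]
  · rw [f.as_sum]
    refine J.sum_mem fun m hm => ?_
    rw [← mul_one (f.coeff m), ← C_mul_monomial]
    exact J.mul_mem_left _ (h m (hf hm))

theorem monomial_mem_restrictSupportIdeal [Nontrivial D] {hE : IsUpperSet E} {m : σ →₀ ℕ} :
    monomial m (1 : D) ∈ restrictSupportIdeal D E hE ↔ m ∈ E := by
  classical
  simp [mem_restrictSupportIdeal, support_monomial]

theorem restrictSupportIdeal_inj [Nontrivial D] {hE : IsUpperSet E} {hF : IsUpperSet F} :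
    restrictSupportIdeal D E hE = restrictSupportIdeal D F hF ↔ E = F := by
  refine ⟨fun h => Set.ext fun m => ?_, fun h => by simp only [h]⟩
  rw [← monomial_mem_restrictSupportIdeal (D := D) (hE := hE), h,
    monomial_mem_restrictSupportIdeal]

theorem colon_monomial (hE : IsUpperSet E) (u : σ →₀ ℕ) :
    (restrictSupportIdeal D E hE).colon {monomial u 1} =
      restrictSupportIdeal D ((u + ·) ⁻¹' E) (hE.preimage add_right_mono) := by
  ext f
  rw [Submodule.mem_colon_singleton, smul_eq_mul, mem_restrictSupportIdeal,
    mem_restrictSupportIdeal]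
  refine ⟨fun h m hm => h (u + m) ?_, fun h n hn => ?_⟩
  · rwa [mem_support_iff, add_comm, coeff_mul_monomial, mul_one, ← mem_support_iff]
  · classical
    rw [mem_support_iff, coeff_mul_monomial'] at hn
    split_ifs at hn with hun
    · simpa [add_tsub_cancel_of_le hun] using h (n - u) (by simpa using hn)
    · exact absurd rfl hn

theorem isUpperSet_exists_ne_zero (s : Set σ) : IsUpperSet {m : σ →₀ ℕ | ∃ i ∈ s, m i ≠ 0} :=
  fun _ _ hmn ⟨i, hi, hm⟩ => ⟨i, hi, ((Nat.pos_of_ne_zero hm).trans_le (hmn i)).ne'⟩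

theorem span_X_image_eq_restrictSupportIdeal (s : Set σ) :
    Ideal.span (X '' s) = restrictSupportIdeal D {m | ∃ i ∈ s, m i ≠ 0}
      (isUpperSet_exists_ne_zero s) :=
  Ideal.ext fun _ => mem_ideal_span_X_image

theorem span_X_image_injective [Nontrivial D] :
    Function.Injective fun s : Set σ => Ideal.span (X '' s : Set (MvPolynomial σ D)) := by
  classical
  intro s t hst
  simp only [span_X_image_eq_restrictSupportIdeal] at hst
  ext i
  simpa [Finsupp.single_apply] using
    Set.ext_iff.mp (restrictSupportIdeal_inj.mp hst) (Finsupp.single i 1)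

theorem isPrime_span_X_image [IsDomain D] (s : Set σ) :
    (Ideal.span (X '' s : Set (MvPolynomial σ D))).IsPrime := by
  classical
  have hmem (f : MvPolynomial σ D) :
      f ∈ Ideal.span (X '' s) ↔ 1 ≤ weightValuation D (s.indicator 1) f := by
    rw [mem_ideal_span_X_image, ← Nat.cast_one, le_weightValuation_iff]
    refine forall₂_congr fun m _ => ?_
    simp [Nat.one_le_iff_ne_zero, Finsupp.weight_apply, Finsupp.sum, Set.indicator_apply,
      and_left_comm]
  refine Ideal.isPrime_iff.mpr ⟨fun h => ?_, fun {f g} hfg => ?_⟩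
  · simpa using (hmem 1).mp (h ▸ Submodule.mem_top)
  · by_contra! hnot
    simp only [hmem, Order.one_le_iff_ne_zero, not_not] at hnot
    simp [hmem, hnot] at hfg

theorem restrictSupportIdeal_mul_le {G : Set (σ →₀ ℕ)} (hE : IsUpperSet E) (hF : IsUpperSet F)
    (hG : IsUpperSet G) (h : ∀ m ∈ E, ∀ n ∈ F, m + n ∈ G) :
    restrictSupportIdeal D E hE * restrictSupportIdeal D F hF ≤ restrictSupportIdeal D G hG := by
  classical
  refine Ideal.mul_le.mpr fun f hf g hg => mem_restrictSupportIdeal.mpr fun l hl => ?_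
  obtain ⟨m, hm, n, hn, rfl⟩ := Finset.mem_add.mp (support_mul f g hl)
  exact h m (hf hm) n (hg hn)

theorem IsIntegralOverIdeal.le_weight [IsDomain D] {w : σ → ℕ} {h : ℕ} {hE : IsUpperSet E}
    (hw : ∀ m ∈ E, h ≤ Finsupp.weight w m) {f : MvPolynomial σ D}
    (hf : IsIntegralOverIdeal (restrictSupportIdeal D E hE) f) :
    ∀ m ∈ f.support, h ≤ Finsupp.weight w m :=
  le_weightValuation_iff.mp <| hf.le_addValuation fun _ hg =>
    le_weightValuation_iff.mpr fun m hm => hw m (mem_restrictSupportIdeal.mp hg m hm)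

end MonomialIdeals

section AssociatedPrimes

theorem mem_Ass_iff {R : Type*} [CommRing R] [IsNoetherianRing R] {J P : Ideal R} :
    P ∈ Ass J ↔ P.IsPrime ∧ ∃ f, P = J.colon {f} := by
  rw [Ass, AssociatedPrimes.mem_iff, isAssociatedPrime_iff, Ideal.Quotient.mk_surjective.exists]
  refine and_congr_right fun _ => exists_congr fun f => ?_
  suffices (⊥ : Submodule R (R ⧸ J)).colon {Ideal.Quotient.mk J f} = J.colon {f} by rw [this]
  ext g
  rw [Submodule.mem_colon_singleton, Submodule.mem_colon_singleton, Submodule.mem_bot,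
    smul_eq_mul, ← Ideal.Quotient.eq_zero_iff_mem, map_mul, Algebra.smul_def,
    Ideal.Quotient.algebraMap_eq]

variable {σ D : Type*} [CommRing D] {E : Set (σ →₀ ℕ)} {hE : IsUpperSet E}
  {P : Ideal (MvPolynomial σ D)} {f g : MvPolynomial σ D}

theorem support_subLTerm [DecidableEq σ] (o : MonomialOrder σ) (f : MvPolynomial σ D) :
    (o.subLTerm f).support = f.support.erase (o.degree f) := by
  ext m
  rw [mem_support_iff, MonomialOrder.subLTerm, coeff_sub, coeff_monomial, Finset.mem_erase,
    mem_support_iff]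
  split_ifs with h
  · simp [← h, MonomialOrder.leadingCoeff]
  · simp [Ne.symm h]

theorem card_support_subLTerm_lt (o : MonomialOrder σ) (hf : f ≠ 0) :
    (o.subLTerm f).support.card < f.support.card := by
  classical
  rw [support_subLTerm]
  exact Finset.card_erase_lt_of_mem (o.degree_mem_support hf)

theorem card_support_monomial_mul_le (u : σ →₀ ℕ) (f : MvPolynomial σ D) :
    (monomial u 1 * f).support.card ≤ f.support.card := by
  classical
  calc (monomial u 1 * f).support.card ≤ (monomial u (1 : D)).support.card * f.support.card :=
        (Finset.card_le_card (support_mul _ _)).trans Finset.card_add_le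
    _ ≤ 1 * f.support.card :=
        Nat.mul_le_mul_right _ (Finset.card_le_card support_monomial_subset)
    _ = f.support.card := one_mul _

theorem degree_add_degree_mem [NoZeroDivisors D] (o : MonomialOrder σ) (hf : f ≠ 0) (hg : g ≠ 0)
    (hgf : g * f ∈ restrictSupportIdeal D E hE) : o.degree g + o.degree f ∈ E := by
  refine mem_restrictSupportIdeal.mp hgf _ (mem_support_iff.mpr ?_)
  rw [o.coeff_mul_of_degree_add]
  exact mul_ne_zero (o.leadingCoeff_ne_zero_iff.mpr hg) (o.leadingCoeff_ne_zero_iff.mpr hf)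

theorem eq_colon_monomial_mul_subLTerm (o : MonomialOrder σ) (hP : P.IsPrime)
    (hf : P = (restrictSupportIdeal D E hE).colon {f}) {u : σ →₀ ℕ} (hu : u + o.degree f ∈ E)
    (huP : monomial u 1 ∉ P) :
    P = (restrictSupportIdeal D E hE).colon {monomial u 1 * o.subLTerm f} := by
  have hlead : monomial u 1 * monomial (o.degree f) (o.leadingCoeff f) ∈
      restrictSupportIdeal D E hE := by
    rw [monomial_mul]
    intro m hm
    rwa [Finset.mem_singleton.mp (support_monomial_subset hm)]
  ext h
  have hsplit : h * (monomial u 1 * o.subLTerm f) =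
      h * monomial u 1 * f - h * (monomial u 1 * monomial (o.degree f) (o.leadingCoeff f)) := by
    rw [MonomialOrder.subLTerm]
    ring
  rw [Submodule.mem_colon_singleton, smul_eq_mul, hsplit,
    Submodule.sub_mem_iff_left _ (Ideal.mul_mem_left _ h hlead), ← smul_eq_mul,
    ← Submodule.mem_colon_singleton, ← hf, hP.mul_mem_iff_mem_or_mem, or_iff_left huP]

theorem monomial_degree_mem_of_eq_colon [NoZeroDivisors D] (o : MonomialOrder σ) (hP : P.IsPrime)
    (hf : P = (restrictSupportIdeal D E hE).colon {f}) (hg : g ∈ P) (hg0 : g ≠ 0) :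
    monomial (o.degree g) 1 ∈ P := by
  induction hn : f.support.card using Nat.strong_induction_on generalizing f with
  | _ n ih =>
    subst hn
    -- If the leading monomial of `g` is not in `P`, multiplying `f` by it and dropping the leading
    -- term, which lands in the ideal, leaves `P` unchanged and makes `f` shorter.
    by_contra hgP
    have hf0 : f ≠ 0 := by
      rintro rfl
      exact hP.ne_top (by simp [hf])
    have hgf : g * f ∈ restrictSupportIdeal D E hE := by
      rwa [hf, Submodule.mem_colon_singleton] at hg
    have hcard := (card_support_monomial_mul_le (o.degree g) (o.subLTerm f)).trans_lt
      (card_support_subLTerm_lt o hf0)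
    exact hgP (ih _ hcard
      (eq_colon_monomial_mul_subLTerm o hP hf (degree_add_degree_mem o hf0 hg0 hgf) hgP) rfl)

theorem monomial_mem_of_eq_colon [NoZeroDivisors D] (o : MonomialOrder σ) (hP : P.IsPrime)
    (hf : P = (restrictSupportIdeal D E hE).colon {f}) (hg : g ∈ P) {m : σ →₀ ℕ}
    (hm : m ∈ g.support) : monomial m 1 ∈ P := by
  classical
  induction hn : g.support.card using Nat.strong_induction_on generalizing g with
  | _ n ih =>
    subst hn
    have hg0 : g ≠ 0 := by
      rintro rfl
      simp at hm
    have hlead := monomial_degree_mem_of_eq_colon o hP hf hg hg0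
    by_cases hmd : m = o.degree g
    · rwa [hmd]
    · refine ih _ (card_support_subLTerm_lt o hg0) ?_ ?_ rfl
      · rw [MonomialOrder.subLTerm, ← mul_one (o.leadingCoeff g), ← C_mul_monomial]
        exact P.sub_mem hg (P.mul_mem_left _ hlead)
      · rw [support_subLTerm]
        exact Finset.mem_erase.mpr ⟨hmd, hm⟩

theorem exists_eq_colon_monomial [NoZeroDivisors D] (o : MonomialOrder σ) (hP : P.IsPrime)
    (hf : P = (restrictSupportIdeal D E hE).colon {f}) :
    ∃ u, P = (restrictSupportIdeal D E hE).colon {monomial u 1} := by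
  have hle : f.support.inf (fun u => (restrictSupportIdeal D E hE).colon {monomial u 1}) ≤ P := by
    intro g hg
    rw [hf, Submodule.mem_colon_singleton, smul_eq_mul, f.as_sum, Finset.mul_sum]
    refine Ideal.sum_mem _ fun u hu => ?_
    have hgu := Submodule.mem_colon_singleton.mp (Submodule.mem_finsetInf.mp hg u hu)
    rw [← mul_one (f.coeff u), ← C_mul_monomial, mul_left_comm]
    exact Ideal.mul_mem_left _ _ hgu
  obtain ⟨u, hu, huP⟩ := hP.inf_le'.mp hle
  refine ⟨u, le_antisymm (fun g hg => ?_) huP⟩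
  rw [colon_monomial]
  refine mem_restrictSupportIdeal.mpr fun m hm => ?_
  have hmf : monomial m 1 * f ∈ restrictSupportIdeal D E hE := by
    have := monomial_mem_of_eq_colon o hP hf hg hm
    rwa [hf, Submodule.mem_colon_singleton] at this
  refine Set.mem_preimage.mpr (mem_restrictSupportIdeal.mp hmf _ (mem_support_iff.mpr ?_))
  rw [add_comm, coeff_monomial_mul, one_mul]
  exact mem_support_iff.mp hu

theorem eq_span_X_image_of_monomial_mem (hP : P.IsPrime)
    (h : ∀ g ∈ P, ∀ m ∈ g.support, monomial m 1 ∈ P) : P = Ideal.span (X '' {i | X i ∈ P}) := by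
  refine le_antisymm (fun g hg => mem_ideal_span_X_image.mpr fun m hm => ?_) ?_
  · have hmP := h g hg m hm
    rw [monomial_eq, C_1, one_mul, Finsupp.prod, hP.prod_mem_iff] at hmP
    obtain ⟨i, hi, hiP⟩ := hmP
    exact ⟨i, hP.mem_of_pow_mem _ hiP, Finsupp.mem_support_iff.mp hi⟩
  · rw [Ideal.span_le]
    rintro _ ⟨i, hi, rfl⟩
    exact hi

/-- The sets `s` of variables for which some translate of the set `E` of exponents meets the
monomials exactly in those divisible by a variable of `s`. If `E` is the set of exponents of a
monomial ideal, they are the sets of variables that generate its associated primes. -/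
def associatedVars (E : Set (σ →₀ ℕ)) : Set (Set σ) :=
  {s | ∃ u, ∀ m, u + m ∈ E ↔ ∃ i ∈ s, m i ≠ 0}

theorem exists_ne_zero_of_mem_associatedVars (hE : IsUpperSet E) {s : Set σ}
    (hs : s ∈ associatedVars E) {m : σ →₀ ℕ} (hm : m ∈ E) : ∃ i ∈ s, m i ≠ 0 := by
  obtain ⟨u, hu⟩ := hs
  exact (hu m).mp (hE le_add_self hm)

theorem Ass_restrictSupportIdeal [Finite σ] [IsDomain D] [IsNoetherianRing D] (hE : IsUpperSet E) :
    Ass (restrictSupportIdeal D E hE) = (fun s => Ideal.span (X '' s)) '' associatedVars E := by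
  let _ : LinearOrder σ := IsWellOrder.linearOrder WellOrderingRel
  have hcolon (s : Set σ) (u : σ →₀ ℕ) :
      Ideal.span (X '' s) = (restrictSupportIdeal D E hE).colon {monomial u 1} ↔
        ∀ m, u + m ∈ E ↔ ∃ i ∈ s, m i ≠ 0 := by
    rw [colon_monomial, span_X_image_eq_restrictSupportIdeal, restrictSupportIdeal_inj, eq_comm,
      Set.ext_iff]
    rfl
  ext P
  rw [mem_Ass_iff]
  constructor
  · rintro ⟨hP, f, hf⟩
    have hspan := eq_span_X_image_of_monomial_mem hP fun g hg m hm =>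
      monomial_mem_of_eq_colon MonomialOrder.lex hP hf hg hm
    obtain ⟨u, hu⟩ := exists_eq_colon_monomial MonomialOrder.lex hP hf
    exact ⟨_, ⟨u, (hcolon _ u).mp (hspan.symm.trans hu)⟩, hspan.symm⟩
  · rintro ⟨s, ⟨u, hu⟩, rfl⟩
    exact ⟨isPrime_span_X_image s, monomial u 1, (hcolon s u).mpr hu⟩

/-- `u` is the exponent of a monomial outside the monomial ideal with exponent set `E` that every
variable multiplies into the ideal: a monomial of the socle of the quotient ring. -/
def IsSocleExponent (E : Set (σ →₀ ℕ)) (u : σ →₀ ℕ) : Prop :=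
  u ∉ E ∧ ∀ i, u + Finsupp.single i 1 ∈ E

theorem univ_mem_associatedVars_iff (hE : IsUpperSet E) :
    Set.univ ∈ associatedVars E ↔ ∃ u, IsSocleExponent E u := by
  simp only [associatedVars, Set.mem_ofPred_eq, Set.mem_univ, true_and]
  refine exists_congr fun u => ⟨fun h => ⟨?_, fun i => (h _).mpr ⟨i, by simp⟩⟩, ?_⟩
  · simpa using h 0
  · rintro ⟨hu, hsingle⟩ m
    refine ⟨fun hm => ?_, fun ⟨i, hi⟩ => ?_⟩
    · by_contra! hm0
      exact hu (by simpa [Finsupp.ext (g := 0) hm0] using hm)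
    · refine hE (add_le_add_right ?_ u) (hsingle i)
      rwa [Finsupp.single_le_iff, Nat.one_le_iff_ne_zero]

end AssociatedPrimes

section Exponents

/-- The exponents of the monomials in the `k`-th power of
`(x ^ (2c+2), x y ^ (2c) z, y ^ (2c+2) z)`: such a monomial is divisible by a product of `a`, `b`
and `e` factors equal to the three generators, respectively. -/
def powExponents (c k : ℕ) : Set (Fin 3 →₀ ℕ) :=
  {m | ∃ a b e, a + b + e = k ∧ (2 * c + 2) * a + b ≤ m 0 ∧
    2 * c * b + (2 * c + 2) * e ≤ m 1 ∧ b + e ≤ m 2}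

/-- The lattice points of `k` times the Newton polyhedron of
`(x ^ (2c+2), x y ^ (2c) z, y ^ (2c+2) z)`, each inequality being a facet that is not a coordinate
plane (the second one is void if `c = 0`). -/
def newtonExponents (c k : ℕ) : Set (Fin 3 →₀ ℕ) :=
  {m | (2 * c + 2) * k ≤ m 0 + (2 * c + 2) * m 2 ∧
    2 * c * ((2 * c + 2) * k) ≤ 2 * c * m 0 + (2 * c + 1) * m 1 ∧
    (2 * c + 2) * k ≤ 2 * m 0 + m 1 ∧
    2 * ((2 * c + 2) * k) ≤ 2 * m 0 + m 1 + (2 * c + 2) * m 2}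

/-- The exponent vector of `x ^ p * y ^ q * z ^ r`. -/
noncomputable def expVec (p q r : ℕ) : Fin 3 →₀ ℕ :=
  Finsupp.equivFunOnFinite.symm ![p, q, r]

@[simp]
theorem coe_expVec (p q r : ℕ) : ⇑(expVec p q r) = ![p, q, r] :=
  rfl

theorem isUpperSet_powExponents (c k : ℕ) : IsUpperSet (powExponents c k) :=
  fun _ _ hmn ⟨a, b, e, hk, hx, hy, hz⟩ =>
    ⟨a, b, e, hk, hx.trans (hmn 0), hy.trans (hmn 1), hz.trans (hmn 2)⟩

theorem isUpperSet_newtonExponents (c k : ℕ) : IsUpperSet (newtonExponents c k) := by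
  rintro m n hmn ⟨hxz, hxy, hy, hxyz⟩
  have hx := hmn 0
  have hy' := hmn 1
  have hz := hmn 2
  refine ⟨hxz.trans ?_, hxy.trans ?_, hy.trans ?_, hxyz.trans ?_⟩ <;> gcongr

theorem powExponents_subset_newtonExponents (c k : ℕ) :
    powExponents c k ⊆ newtonExponents c k := by
  rintro m ⟨a, b, e, rfl, hx, hy, hz⟩
  have hz' := Nat.mul_le_mul_left (2 * c + 2) hz
  refine ⟨by nlinarith, ?_, by nlinarith, by nlinarith⟩
  have hx' := Nat.mul_le_mul_left (2 * c) hx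
  have hy' := Nat.mul_le_mul_left (2 * c + 1) hy
  nlinarith [Nat.zero_le (c * e), Nat.zero_le (c * c * e)]

-- With `D = (2c+2)k` and `E = (2c+2)r`, the number `s` is `2c+2` times the height of a point below
-- `(p, q, r)` in `k` times the triangle spanned by the exponents of the three generators.
theorem exists_scaled_height {c p q D E : ℕ} (hxz : D ≤ p + E)
    (hxy : 2 * c * D ≤ 2 * c * p + (2 * c + 1) * q) (hy : D ≤ 2 * p + q)
    (hxyz : 2 * D ≤ 2 * p + q + E) :
    ∃ s, s ≤ D ∧ s ≤ E ∧ 2 * c * s ≤ (2 * c + 2) * q ∧ D ≤ p + s ∧ 2 * D ≤ 2 * p + q + s := by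
  refine ⟨max (D - p) (2 * D - (2 * p + q)), by omega, by omega, ?_, by omega, by omega⟩
  have hxs : 2 * c * (D - p) ≤ (2 * c + 2) * q := by
    rw [Nat.mul_sub, Nat.sub_le_iff_le_add]
    linarith
  have hxys : 2 * c * (2 * D - (2 * p + q)) ≤ (2 * c + 2) * q := by
    rw [Nat.mul_sub, Nat.sub_le_iff_le_add]
    linarith
  rcases max_choice (D - p) (2 * D - (2 * p + q)) with h | h <;> rwa [h]

theorem nsmul_mem_powExponents {c k : ℕ} {m : Fin 3 →₀ ℕ} (hm : m ∈ newtonExponents c k) :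
    (2 * (2 * c + 2)) • m ∈ powExponents c (k * (2 * (2 * c + 2))) := by
  obtain ⟨hxz, hxy, hy, hxyz⟩ := hm
  obtain ⟨s, hsD, hsE, hsq, hxs, hxys⟩ := exists_scaled_height hxz hxy hy hxyz
  obtain ⟨t, ht⟩ : ∃ t, t = s - m 1 := ⟨_, rfl⟩
  have hts : (2 * c + 2) * t ≤ 2 * s := by
    rw [ht, Nat.mul_sub, Nat.sub_le_iff_le_add]
    linarith
  obtain ⟨a, ha⟩ := Nat.exists_eq_add_of_le hsD
  obtain ⟨e, he⟩ := Nat.exists_eq_add_of_le hts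
  refine ⟨2 * a, (2 * c + 2) * t, e, by nlinarith, ?_, ?_, ?_⟩ <;>
    simp only [Finsupp.smul_apply, smul_eq_mul]
  · have hx : 2 * a + t ≤ 2 * m 0 := by omega
    linarith [Nat.mul_le_mul_left (2 * c + 2) hx]
  · have hq : 2 * c * t + e ≤ 2 * m 1 := by
      have : s ≤ m 1 + t := by omega
      nlinarith
    linarith [Nat.mul_le_mul_left (2 * c + 2) hq]
  · linarith

theorem add_two_le_of_isSocleExponent_powExponents {c k : ℕ} {u : Fin 3 →₀ ℕ}
    (hu : IsSocleExponent (powExponents c k) u) : c + 2 ≤ k := by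
  obtain ⟨hnot, hsingle⟩ := hu
  obtain ⟨a, b, e, hk, hx, -, hz⟩ := hsingle 1
  obtain ⟨a', b', e', hk', hx', hy', hz'⟩ := hsingle 2
  simp only [Finsupp.add_apply, Finsupp.single_apply, Fin.reduceEq, if_false, if_true,
    add_zero] at hx hz hx' hy' hz'
  have hbe : b' + e' = u 2 + 1 := by
    refine le_antisymm hz' ?_
    by_contra! hlt
    exact hnot ⟨a', b', e', hk', hx', hy', Nat.lt_succ_iff.mp hlt⟩
  by_contra! hlt
  refine hnot ⟨k - u 2, 0, u 2, by omega, ?_, ?_, by omega⟩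
  · have ha : (2 * c + 2) * (k - u 2) ≤ (2 * c + 2) * a := Nat.mul_le_mul_left _ (by omega)
    omega
  · have hbe' : 2 * c * (b' + e') = 2 * c * (u 2 + 1) := by rw [hbe]
    nlinarith

theorem isSocleExponent_expVec_iff {E : Set (Fin 3 →₀ ℕ)} {p q r : ℕ} :
    IsSocleExponent E (expVec p q r) ↔ expVec p q r ∉ E ∧
      expVec (p + 1) q r ∈ E ∧ expVec p (q + 1) r ∈ E ∧ expVec p q (r + 1) ∈ E := by
  have hx : expVec p q r + Finsupp.single 0 1 = expVec (p + 1) q r := by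
    ext i; fin_cases i <;> simp
  have hy : expVec p q r + Finsupp.single 1 1 = expVec p (q + 1) r := by
    ext i; fin_cases i <;> simp
  have hz : expVec p q r + Finsupp.single 2 1 = expVec p q (r + 1) := by
    ext i; fin_cases i <;> simp
  simp [IsSocleExponent, Fin.forall_fin_succ, hx, hy, hz]

theorem isSocleExponent_powExponents (c j : ℕ) :
    IsSocleExponent (powExponents c (c + 2 + j))
      (expVec ((2 * c + 2) * (j + 1)) (2 * c ^ 2 + 4 * c + 1) (c + 1)) := by
  refine isSocleExponent_expVec_iff.mpr ⟨?_,
    ⟨j + 1, 1, c, by ring, by simp, ?_, by simp [add_comm]⟩,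
    ⟨j + 1, 0, c + 1, by ring, by simp, ?_, by simp⟩,
    ⟨j, c + 2, 0, by ring, ?_, ?_, by simp⟩⟩
  · rintro ⟨a, b, e, hk, hx, hy, hz⟩
    simp only [coe_expVec, Matrix.cons_val] at hx hy hz
    have ha : a ≤ j + 1 := Nat.le_of_mul_le_mul_left (by omega) (by omega : 0 < 2 * c + 2)
    obtain rfl : a = j + 1 := by omega
    obtain rfl : b = 0 := by omega
    obtain rfl : e = c + 1 := by omega
    nlinarith
  all_goals
    simp only [coe_expVec, Matrix.cons_val]
    nlinarith

theorem not_isSocleExponent_newtonExponents_one (c : ℕ) (u : Fin 3 →₀ ℕ) :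
    ¬ IsSocleExponent (newtonExponents c 1) u := by
  rintro ⟨hnot, hsingle⟩
  obtain ⟨hxz, -, -, -⟩ := hsingle 1
  obtain ⟨-, hxy, hy, -⟩ := hsingle 2
  simp only [Finsupp.add_apply, Finsupp.single_apply, Fin.reduceEq, if_false, add_zero]
    at hxz hxy hy
  refine hnot ⟨hxz, hxy, hy, ?_⟩
  rcases Nat.eq_zero_or_pos (u 2) with hz | hz
  · rw [hz] at hxz ⊢
    linarith
  · nlinarith

theorem isSocleExponent_newtonExponents (c j : ℕ) :
    IsSocleExponent (newtonExponents c (2 + j))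
      (expVec ((2 * c + 2) * (j + 1)) (2 * c + 1) 1) := by
  refine isSocleExponent_expVec_iff.mpr
    ⟨?_, ⟨?_, ?_, ?_, ?_⟩, ⟨?_, ?_, ?_, ?_⟩, ⟨?_, ?_, ?_, ?_⟩⟩
  · rintro ⟨-, -, -, hxyz⟩
    simp only [coe_expVec, Matrix.cons_val] at hxyz
    nlinarith
  all_goals
    simp only [coe_expVec, Matrix.cons_val]
    nlinarith [Nat.zero_le (c * j)]

section AssociatedVars

variable {c k : ℕ} {E : Set (Fin 3 →₀ ℕ)}

theorem zero_one_mem_associatedVars (hk : 1 ≤ k) (hpow : powExponents c k ⊆ E)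
    (hnewton : E ⊆ newtonExponents c k) : {0, 1} ∈ associatedVars E := by
  obtain ⟨j, rfl⟩ := Nat.exists_eq_add_of_le' hk
  refine ⟨expVec 0 ((2 * c + 2) * j + (2 * c + 1)) (j + 1), fun m => ⟨fun hm => ?_, ?_⟩⟩
  · obtain ⟨-, -, hy, -⟩ := hnewton hm
    simp only [Finsupp.add_apply, coe_expVec, Matrix.cons_val] at hy
    by_contra! hm0
    simp only [Set.mem_insert_iff, Set.mem_singleton_iff, forall_eq_or_imp, forall_eq] at hm0
    nlinarith
  · rintro ⟨i, rfl | rfl, hi⟩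
    · refine hpow ⟨0, 1, j, by ring, ?_⟩
      simp only [Finsupp.add_apply, coe_expVec, Matrix.cons_val]
      omega
    · refine hpow ⟨0, 0, j + 1, by ring, ?_⟩
      simp only [Finsupp.add_apply, coe_expVec, Matrix.cons_val, mul_add]
      omega

theorem zero_two_mem_associatedVars (hk : 1 ≤ k) (hpow : powExponents c k ⊆ E)
    (hnewton : E ⊆ newtonExponents c k) : {0, 2} ∈ associatedVars E := by
  obtain ⟨j, rfl⟩ := Nat.exists_eq_add_of_le' hk
  refine ⟨expVec ((2 * c + 2) * j + (2 * c + 1)) (2 * c + 2) 0, fun m => ⟨fun hm => ?_, ?_⟩⟩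
  · obtain ⟨hxz, -, -, -⟩ := hnewton hm
    simp only [Finsupp.add_apply, coe_expVec, Matrix.cons_val] at hxz
    by_contra! hm0
    simp only [Set.mem_insert_iff, Set.mem_singleton_iff, forall_eq_or_imp, forall_eq] at hm0
    nlinarith
  · rintro ⟨i, rfl | rfl, hi⟩
    · refine hpow ⟨j + 1, 0, 0, by ring, ?_⟩
      simp only [Finsupp.add_apply, coe_expVec, Matrix.cons_val, mul_add]
      omega
    · refine hpow ⟨j, 0, 1, by ring, ?_⟩
      simp only [Finsupp.add_apply, coe_expVec, Matrix.cons_val]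
      omega

theorem associatedVars_diff_univ (hk : 1 ≤ k) (hE : IsUpperSet E) (hpow : powExponents c k ⊆ E)
    (hnewton : E ⊆ newtonExponents c k) :
    associatedVars E \ {Set.univ} = {{0, 1}, {0, 2}} := by
  have hx : expVec ((2 * c + 2) * k) 0 0 ∈ E := hpow ⟨k, 0, 0, by simp⟩
  have hyz : expVec 0 ((2 * c + 2) * k) k ∈ E := hpow ⟨0, 0, k, by simp⟩
  refine Set.Subset.antisymm ?_ (Set.pair_subset
    ⟨zero_one_mem_associatedVars hk hpow hnewton, ?_⟩
    ⟨zero_two_mem_associatedVars hk hpow hnewton, ?_⟩)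
  · rintro s ⟨hs, huniv⟩
    have hk0 : k ≠ 0 := by omega
    have h0 : 0 ∈ s := by
      simpa [Fin.exists_fin_succ, hk0] using exists_ne_zero_of_mem_associatedVars hE hs hx
    have h12 : 1 ∈ s ∨ 2 ∈ s := by
      simpa [Fin.exists_fin_succ, hk0] using
        exists_ne_zero_of_mem_associatedVars hE hs hyz
    have hnot : ¬(1 ∈ s ∧ 2 ∈ s) := fun ⟨h1, h2⟩ =>
      huniv (Set.eq_univ_of_forall (by simp [Fin.forall_fin_succ, h0, h1, h2]))
    rcases h12 with h1 | h2
    · left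
      ext i
      fin_cases i <;> simp_all
    · right
      ext i
      fin_cases i <;> simp_all
  · simp [Set.ext_iff, Fin.forall_fin_succ]
  · simp [Set.ext_iff, Fin.forall_fin_succ]

end AssociatedVars

end Exponents

section ExampleIdeal

theorem sInf_stable_eq {α : Type*} {A : ℕ → Set α} {B : Set α} {m : α} {N : ℕ} (hN : 1 ≤ N)
    (hB : ∀ k, 1 ≤ k → A k \ {m} = B) (hm : ∀ k, 1 ≤ k → (m ∈ A k ↔ N ≤ k)) :
    sInf {k₀ | 1 ≤ k₀ ∧ ∀ k, k₀ ≤ k → A k = A k₀} = N := by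
  have hstable : ∀ k, N ≤ k → A k = A N := by
    intro k hk
    rw [← Set.insert_eq_of_mem ((hm k (hN.trans hk)).mpr hk), ← Set.insert_sdiff_singleton,
      hB k (hN.trans hk), ← hB N hN, Set.insert_sdiff_singleton,
      Set.insert_eq_of_mem ((hm N hN).mpr le_rfl)]
  refine le_antisymm (Nat.sInf_le ⟨hN, hstable⟩) (le_csInf ⟨N, hN, hstable⟩ ?_)
  rintro k₀ ⟨hk₀, hk⟩
  rw [← hm k₀ hk₀, ← hk (max k₀ N) (le_max_left _ _), hm _ (hN.trans (le_max_right _ _))]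
  exact le_max_right _ _

variable (D : Type*) [CommRing D]

/-- The ideal `(x ^ (2c+2), x y ^ (2c) z, y ^ (2c+2) z)` of `D[x, y, z]` over an arbitrary
commutative ring `D`; it is `exampleIdeal D c` if `D` is a field. -/
noncomputable def exampleIdealOver (c : ℕ) : Ideal (MvPolynomial (Fin 3) D) :=
  Ideal.span {X 0 ^ (2 * c + 2), X 0 * X 1 ^ (2 * c) * X 2, X 1 ^ (2 * c + 2) * X 2}

variable {D}

theorem monomial_fin_three (m : Fin 3 →₀ ℕ) :
    monomial m (1 : D) = X 0 ^ m 0 * X 1 ^ m 1 * X 2 ^ m 2 := by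
  rw [monomial_eq, C_1, one_mul, Finsupp.prod_fintype _ _ (by simp), Fin.prod_univ_three]

theorem weight_fin_three (w : Fin 3 → ℕ) (m : Fin 3 →₀ ℕ) :
    Finsupp.weight w m = w 0 * m 0 + w 1 * m 1 + w 2 * m 2 := by
  rw [Finsupp.weight_apply, Finsupp.sum_fintype _ _ (by simp), Fin.sum_univ_three]
  simp only [smul_eq_mul, mul_comm]

theorem restrictSupportIdeal_powExponents_le_pow (c k : ℕ) :
    restrictSupportIdeal D (powExponents c k) (isUpperSet_powExponents c k) ≤
      exampleIdealOver D c ^ k := by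
  rw [restrictSupportIdeal_le_iff]
  rintro m ⟨a, b, e, rfl, hx, hy, hz⟩
  have hfactor : monomial m (1 : D) =
      X 0 ^ (m 0 - ((2 * c + 2) * a + b)) * X 1 ^ (m 1 - (2 * c * b + (2 * c + 2) * e)) *
        X 2 ^ (m 2 - (b + e)) * ((X 0 ^ (2 * c + 2)) ^ a * (X 0 * X 1 ^ (2 * c) * X 2) ^ b *
          (X 1 ^ (2 * c + 2) * X 2) ^ e) := by
    rw [monomial_fin_three]
    nth_rw 1 [← Nat.sub_add_cancel hx, ← Nat.sub_add_cancel hy, ← Nat.sub_add_cancel hz]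
    ring
  rw [hfactor, pow_add, pow_add]
  refine Ideal.mul_mem_left _ _ (Ideal.mul_mem_mul (Ideal.mul_mem_mul ?_ ?_) ?_) <;>
    exact Ideal.pow_mem_pow (Ideal.subset_span (by simp)) _

theorem exampleIdealOver_le_restrictSupportIdeal (c : ℕ) : exampleIdealOver D c ≤
    restrictSupportIdeal D (powExponents c 1) (isUpperSet_powExponents c 1) := by
  have hx : (X 0 ^ (2 * c + 2) : MvPolynomial (Fin 3) D) = monomial (expVec (2 * c + 2) 0 0) 1 := by
    simp [monomial_fin_three]
  have hxyz : (X 0 * X 1 ^ (2 * c) * X 2 : MvPolynomial (Fin 3) D) =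
      monomial (expVec 1 (2 * c) 1) 1 := by
    simp [monomial_fin_three]
  have hyz : (X 1 ^ (2 * c + 2) * X 2 : MvPolynomial (Fin 3) D) =
      monomial (expVec 0 (2 * c + 2) 1) 1 := by
    simp [monomial_fin_three]
  rw [exampleIdealOver, hx, hxyz, hyz, Ideal.span_le]
  rintro _ (rfl | rfl | rfl) <;> refine restrictSupportIdeal_le_iff.mp le_rfl _ ?_
  · exact ⟨1, 0, 0, by simp⟩
  · exact ⟨0, 1, 0, by simp⟩
  · exact ⟨0, 0, 1, by simp⟩

theorem exampleIdealOver_pow (c k : ℕ) : exampleIdealOver D c ^ k =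
    restrictSupportIdeal D (powExponents c k) (isUpperSet_powExponents c k) := by
  refine le_antisymm ?_ (restrictSupportIdeal_powExponents_le_pow c k)
  induction k with
  | zero => exact fun f _ m _ => ⟨0, 0, 0, by simp⟩
  | succ k ih =>
    rw [pow_succ]
    refine (Ideal.mul_mono ih (exampleIdealOver_le_restrictSupportIdeal c)).trans
      (restrictSupportIdeal_mul_le _ _ _ ?_)
    rintro m ⟨a, b, e, hk, hx, hy, hz⟩ n ⟨a', b', e', hk', hx', hy', hz'⟩
    refine ⟨a + a', b + b', e + e', by omega, ?_⟩
    simp only [Finsupp.add_apply, mul_add]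
    omega

theorem idealIntegralClosure_exampleIdealOver_pow [IsDomain D] (c k : ℕ) :
    idealIntegralClosure (exampleIdealOver D c ^ k) =
      restrictSupportIdeal D (newtonExponents c k) (isUpperSet_newtonExponents c k) := by
  refine le_antisymm (fun f hf m hm => ?_) (restrictSupportIdeal_le_iff.mpr fun m hm => ?_)
  · rw [exampleIdealOver_pow] at hf
    have hweight (w : Fin 3 → ℕ) (h : ℕ)
        (hw : ∀ n ∈ newtonExponents c k, h ≤ w 0 * n 0 + w 1 * n 1 + w 2 * n 2) :
        h ≤ w 0 * m 0 + w 1 * m 1 + w 2 * m 2 := by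
      simp only [← weight_fin_three] at hw ⊢
      exact IsIntegralOverIdeal.le_weight
        (fun n hn => hw n (powExponents_subset_newtonExponents c k hn)) hf m hm
    refine ⟨?_, ?_, ?_, ?_⟩
    · simpa using hweight ![1, 0, 2 * c + 2] _ fun n hn => by simpa using hn.1
    · simpa using hweight ![2 * c, 2 * c + 1, 0] _ fun n hn => by simpa using hn.2.1
    · simpa using hweight ![2, 1, 0] _ fun n hn => by simpa using hn.2.2.1
    · simpa using hweight ![2, 1, 2 * c + 2] _ fun n hn => by simpa using hn.2.2.2
  · refine isIntegralOverIdeal_of_pow_mem (n := 2 * (2 * c + 2)) (by omega) ?_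
    rw [← pow_mul, monomial_pow, one_pow, exampleIdealOver_pow]
    exact monomial_mem_restrictSupportIdeal.mpr (nsmul_mem_powExponents hm)

variable [IsDomain D] [IsNoetherianRing D]

theorem sInf_stable_Ass_restrictSupportIdeal_eq {c N : ℕ} {E : ℕ → Set (Fin 3 →₀ ℕ)}
    (hE : ∀ k, IsUpperSet (E k)) (hpow : ∀ k, powExponents c k ⊆ E k)
    (hnewton : ∀ k, E k ⊆ newtonExponents c k) (hN : 1 ≤ N)
    (hsocle : ∀ k, 1 ≤ k → ((∃ u, IsSocleExponent (E k) u) ↔ N ≤ k)) :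
    sInf {k₀ | 1 ≤ k₀ ∧ ∀ k, k₀ ≤ k → Ass (restrictSupportIdeal D (E k) (hE k)) =
      Ass (restrictSupportIdeal D (E k₀) (hE k₀))} = N := by
  simp only [Ass_restrictSupportIdeal, span_X_image_injective.image_injective.eq_iff]
  refine sInf_stable_eq hN
    (fun k hk => associatedVars_diff_univ hk (hE k) (hpow k) (hnewton k)) fun k hk => ?_
  rw [univ_mem_associatedVars_iff (hE k), hsocle k hk]

theorem astab_exampleIdealOver (c : ℕ) : astab (exampleIdealOver D c) = c + 2 := by
  simp only [astab, exampleIdealOver_pow]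
  refine sInf_stable_Ass_restrictSupportIdeal_eq (isUpperSet_powExponents c)
    (fun k => subset_rfl) (powExponents_subset_newtonExponents c) (by omega)
    fun k _ => ⟨fun ⟨u, hu⟩ => add_two_le_of_isSocleExponent_powExponents hu, fun hk => ?_⟩
  obtain ⟨j, rfl⟩ := Nat.exists_eq_add_of_le hk
  exact ⟨_, isSocleExponent_powExponents c j⟩

theorem astabBar_exampleIdealOver (c : ℕ) : astabBar (exampleIdealOver D c) = 2 := by
  simp only [astabBar, idealIntegralClosure_exampleIdealOver_pow]
  refine sInf_stable_Ass_restrictSupportIdeal_eq (isUpperSet_newtonExponents c)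
    (powExponents_subset_newtonExponents c) (fun k => subset_rfl) (by omega)
    fun k hk => ⟨fun ⟨u, hu⟩ => ?_, fun hk2 => ?_⟩
  · by_contra! hlt
    obtain rfl : k = 1 := by omega
    exact not_isSocleExponent_newtonExponents_one c u hu
  · obtain ⟨j, rfl⟩ := Nat.exists_eq_add_of_le hk2
    exact ⟨_, isSocleExponent_newtonExponents c j⟩

end ExampleIdeal

end AssStability

theorem theorem1p4_general (D : Type*) [CommRing D] [IsDomain D] [IsNoetherianRing D] (c : ℕ) :
    AssStability.astab (AssStability.exampleIdealOver D c) = c + 2 ∧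
    AssStability.astabBar (AssStability.exampleIdealOver D c) = 2 ∧
    (AssStability.astab (AssStability.exampleIdealOver D c) : ℤ) -
      (AssStability.astabBar (AssStability.exampleIdealOver D c) : ℤ) = (c : ℤ) := by
  rw [AssStability.astab_exampleIdealOver, AssStability.astabBar_exampleIdealOver]
  refine ⟨rfl, rfl, ?_⟩
  push_cast
  ring

theorem theorem1p4 (K : Type*) [Field K] (c : ℕ) (hc : 0 < c) :
    AssStability.astab (AssStability.exampleIdeal K c) = c + 2 ∧
    AssStability.astabBar (AssStability.exampleIdeal K c) = 2 ∧
    (AssStability.astab (AssStability.exampleIdeal K c) : ℤ) -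
      (AssStability.astabBar (AssStability.exampleIdeal K c) : ℤ) = (c : ℤ) :=
  theorem1p4_general K c
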